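/- Let $T_m=\frac{m(m+1)}{2}$ $(m\in\mathbb{Z}_{\ge 0})$ denote the $m$-th triangular number, and let $$S=\{\,n\in\mathbb{Z}_{>0} : 2x^2+3y^2+4z^2=8n+9 \text{ for some } x,y,z\in\mathbb{Z}\,\}.$$ For positive integers $b_1,\dots,b_k$ let $f(x_1,\dots,x_k)=\sum_{i=1}^k b_iT_{x_i}$, and say that $f$ represents a set $A$ of integers if for every $n\in A$ there are $x_1,\dots,x_k\in\mathbb{Z}_{\ge 0}$ with $f(x_1,\dots,x_k)=n$. Then, for every choice of $k$ and of positive integers $b_1,\dots,b_k$, the sum of triangular numbers $f$ represents $S$ if and only if it represents $$\{2,\ 3,\ 4,\ 5,\ 10,\ 16,\ 17,\ 19,\ 89\}.$$ -/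

import Mathlib

/-- The `n`-th triangular number `T_n = n (n + 1) / 2` (the division is exact), including `T_0 = 0`. -/
def triangular (n : ℕ) : ℕ := n * (n + 1) / 2

/-- The sum of triangular numbers `f_b(x) = ∑ i, b_i T_{x_i}` with coefficients `b`. -/
def triangularSum {k : ℕ} (b x : Fin k → ℕ) : ℕ := ∑ i, b i * triangular (x i)

/-- The sum of triangular numbers `f_b` represents the set `A`: every element of `A` is a value
of `f_b`. -/
def RepresentsSet {k : ℕ} (b : Fin k → ℕ) (A : Set ℕ) : Prop :=
  ∀ n ∈ A, ∃ x : Fin k → ℕ, triangularSum b x = n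

/-- The set `S` of positive integers `n` such that `2x² + 3y² + 4z² = 8n + 9` has a solution in
integers. -/
def curiousSet : Set ℕ :=
  {n | 0 < n ∧ ∃ x y z : ℤ, 2 * x ^ 2 + 3 * y ^ 2 + 4 * z ^ 2 = 8 * (n : ℤ) + 9}

/-!
Completing squares, `2x² + 3y² + 4z² = 8n + 9` forces `x, y, z` to be odd, so `curiousSet` consists
of the positive values of `2 T_x + 3 T_y + 4 T_z`. In particular it contains the nine critical
numbers, and it omits `1` and `8`; only these facts about it are used.

For the converse, the coefficients needed to represent the critical numbers are found by escalation
(`exists_cons_le_of_mem_triangularValues`): representing `2`, `3`, `4`, `5` forces a sub-multiset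
`{1, 1, c}` with `c ≤ 5`, `{1, 2, c}` with `c ≤ 4`, `{2, 3, 4}` or `{2, 2, 3}`. All of these other
than `{1, 1, 3}`, `{2, 2, 3}` and `{2, 3, 4}` are universal (Liouville), and each such universality
is deduced from the theorem on sums of three squares by a change of variables. This includes
`{1, 1, 5}` and `{1, 2, 3}`, whose forms are, over `ℚ`, multiples of the sum of three squares.

The forms of `{1, 1, 3}` and `{2, 2, 3}` both reduce to `x² + y² + 3z²`, which represents every odd
`N` not of the form `9^k (9m + 6)`. A further coefficient, forced by `10` or `17`, repairs these
exceptions by a congruence argument modulo `9`, except that `16` may be missed by `{2, 2, 3, 6}` and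
that the sums with coefficients `{1, 1, 3, 12}` and `{2, 2, 3, 3}` may miss one number for each
power of `9`. The numbers `89` and `19` force one more coefficient in these two cases, and as the
remaining exceptions are sparse, subtracting that coefficient once is enough.

The ternary theorems are proved as Dirichlet did for three squares: primes in arithmetic
progressions and quadratic reciprocity for the Jacobi symbol produce a positive definite integral
ternary form of determinant `1` or `3` representing `N`, and Hermite reduction
(`ternaryForm_reduction`) identifies its class. In determinant `3` there are two classes, told apart
by the residues modulo `8` of their values.
-/

open scoped NumberTheorySymbols Pointwise

/-! ### Reduction of ternary quadratic forms -/

/-- The integral ternary quadratic form with Gram matrix `!![a, t, s; t, b, r; s, r, c]`. -/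
def ternaryForm (a b c r s t x y z : ℤ) : ℤ :=
  a * x ^ 2 + b * y ^ 2 + c * z ^ 2 + 2 * r * (y * z) + 2 * s * (x * z) + 2 * t * (x * y)

theorem exists_two_mul_abs_add_mul_le (g : ℤ) {m : ℤ} (hm : 0 < m) :
    ∃ k : ℤ, 2 * |g + k * m| ≤ m := by
  refine ⟨-((2 * g + m) / (2 * m)), ?_⟩
  have h1 := Int.emod_add_mul_ediv (2 * g + m) (2 * m)
  have h2 := Int.emod_nonneg (2 * g + m) (b := 2 * m) (by omega)
  have h3 := Int.emod_lt_of_pos (2 * g + m) (b := 2 * m) (by omega)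
  set q := (2 * g + m) / (2 * m)
  set e := (2 * g + m) % (2 * m)
  have h4 : 2 * (g + -q * m) = e - m := by linear_combination -h1
  have h5 : |2 * (g + -q * m)| ≤ m := by
    rw [h4, abs_le]; constructor <;> linarith
  rwa [abs_mul, abs_two] at h5

theorem four_mul_sq_le_of_two_mul_abs_le {g m : ℤ} (h : 2 * |g| ≤ m) : 4 * g ^ 2 ≤ m ^ 2 := by
  have := abs_le.1 (show |2 * g| ≤ m by rwa [abs_mul, abs_two])
  nlinarith [this.1, this.2]

theorem eq_one_of_hermite_bounds {a g D : ℤ} (hD : D ≤ 3) (ha : 0 < a) (h1 : 3 * a ^ 2 ≤ 4 * g)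
    (h2 : 3 * g ^ 2 ≤ 4 * (a * D)) : a = 1 := by
  have h3 : (3 * a ^ 2) ^ 2 ≤ (4 * g) ^ 2 := pow_le_pow_left₀ (by positivity) h1 2
  have h4 : a * (27 * a ^ 3) ≤ a * (64 * 3) := by
    calc a * (27 * a ^ 3) = 3 * (3 * a ^ 2) ^ 2 := by ring
      _ ≤ 16 * (3 * g ^ 2) := by linarith
      _ ≤ 64 * (a * D) := by linarith
      _ ≤ 64 * (a * 3) := by gcongr
      _ = a * (64 * 3) := by ring
  have h5 := le_of_mul_le_mul_left h4 ha
  by_contra hne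
  have h6 : (2 : ℤ) ^ 3 ≤ a ^ 3 := pow_le_pow_left₀ (by norm_num) (by omega) 3
  linarith

/-- **Hermite reduction.** A positive definite integral ternary form of determinant `D ≤ 3` takes
only values of a form `u² + (β v² + 2 ρ v w + γ w²)` whose binary part is Gauss-reduced of
determinant `D`. The recursion decreases lexicographically the leading coefficient `a` and the
leading minor `a b - t²`. -/
theorem ternaryForm_reduction {D : ℤ} (hD : D ≤ 3) (a b c r s t : ℤ) (ha : 0 < a)
    (hg : 0 < a * b - t ^ 2)
    (hdet : a * b * c + 2 * r * s * t - a * r ^ 2 - b * s ^ 2 - c * t ^ 2 = D) (hD0 : 0 < D) :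
    ∃ β ρ γ : ℤ, 0 < β ∧ β * γ - ρ ^ 2 = D ∧ 2 * |ρ| ≤ β ∧ β ≤ γ ∧
      ∀ x y z, ∃ u v w, ternaryForm a b c r s t x y z =
        u ^ 2 + β * v ^ 2 + 2 * ρ * (v * w) + γ * w ^ 2 := by
  -- Replace `e₃` by `e₃ + k e₂` to make the off-diagonal entry of the projected binary form small.
  obtain ⟨k, hk⟩ := exists_two_mul_abs_add_mul_le (a * r - s * t) hg
  obtain ⟨c', hc'⟩ : ∃ c', c' = c + 2 * k * r + k ^ 2 * b := ⟨_, rfl⟩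
  obtain ⟨r', hr'⟩ : ∃ r', r' = r + k * b := ⟨_, rfl⟩
  obtain ⟨s', hs'⟩ : ∃ s', s' = s + k * t := ⟨_, rfl⟩
  have hQ1 : ∀ x y z, ternaryForm a b c r s t x y z =
      ternaryForm a b c' r' s' t x (y - k * z) z := by
    intro x y z; simp only [ternaryForm, hc', hr', hs']; ring
  have hdet' : a * b * c' + 2 * r' * s' * t - a * r' ^ 2 - b * s' ^ 2 - c' * t ^ 2 = D := by
    rw [← hdet, hc', hr', hs']; ring
  have hk' : 2 * |a * r' - s' * t| ≤ a * b - t ^ 2 := by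
    have : a * r' - s' * t = a * r - s * t + k * (a * b - t ^ 2) := by rw [hr', hs']; ring
    rwa [this]
  have hk2 := four_mul_sq_le_of_two_mul_abs_le hk'
  have hmin : (a * b - t ^ 2) * (a * c' - s' ^ 2) = a * D + (a * r' - s' * t) ^ 2 := by
    rw [← hdet']; ring
  by_cases hlt : a * c' - s' ^ 2 < a * b - t ^ 2
  · have hpos : 0 < a * c' - s' ^ 2 := by
      have : 0 < (a * b - t ^ 2) * (a * c' - s' ^ 2) := by rw [hmin]; positivity
      exact pos_of_mul_pos_right this hg.le
    obtain ⟨β, ρ, γ, h1, h2, h3, h4, h5⟩ := ternaryForm_reduction hD a c' b r' t s' ha hpos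
      (by rw [← hdet']; ring) hD0
    refine ⟨β, ρ, γ, h1, h2, h3, h4, fun x y z => ?_⟩
    obtain ⟨u, v, w, h⟩ := h5 x z (y - k * z)
    refine ⟨u, v, w, ?_⟩
    rw [hQ1, ← h]; simp only [ternaryForm]; ring
  -- Now the projected binary form is reduced; make `t` small by `e₂ ↦ e₂ + l e₁`.
  obtain ⟨l, hl⟩ := exists_two_mul_abs_add_mul_le t ha
  obtain ⟨b', hb'⟩ : ∃ b', b' = b + 2 * l * t + l ^ 2 * a := ⟨_, rfl⟩
  obtain ⟨r'', hr''⟩ : ∃ r'', r'' = r' + l * s' := ⟨_, rfl⟩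
  obtain ⟨t', ht'⟩ : ∃ t', t' = t + l * a := ⟨_, rfl⟩
  have hQ2 : ∀ x y z, ternaryForm a b c' r' s' t x y z =
      ternaryForm a b' c' r'' s' t' (x - l * y) y z := by
    intro x y z; simp only [ternaryForm, hb', hr'', ht']; ring
  have hdet'' : a * b' * c' + 2 * r'' * s' * t' - a * r'' ^ 2 - b' * s' ^ 2 - c' * t' ^ 2 = D := by
    rw [← hdet', hb', hr'', ht']; ring
  have hg' : a * b' - t' ^ 2 = a * b - t ^ 2 := by rw [hb', ht']; ring
  have hgr : a * r'' - s' * t' = a * r' - s' * t := by rw [hr'', ht']; ring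
  rw [← ht'] at hl
  have hl2 := four_mul_sq_le_of_two_mul_abs_le hl
  rw [← hg', ← hgr] at hk'
  rw [← hg'] at hlt
  have hgpos : 0 < a * b' - t' ^ 2 := by rw [hg']; exact hg
  by_cases hba : b' < a
  · have hb'0 : 0 < b' := by
      have : 0 < a * b' := by nlinarith [sq_nonneg t']
      exact pos_of_mul_pos_right this ha.le
    obtain ⟨β, ρ, γ, h1, h2, h3, h4, h5⟩ := ternaryForm_reduction hD b' a c' s' r'' t' hb'0
      (by linarith) (by rw [← hdet'']; ring) hD0
    refine ⟨β, ρ, γ, h1, h2, h3, h4, fun x y z => ?_⟩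
    obtain ⟨u, v, w, h⟩ := h5 (y - k * z) (x - l * (y - k * z)) z
    refine ⟨u, v, w, ?_⟩
    rw [hQ1, hQ2, ← h]; simp only [ternaryForm]; ring
  -- Hermite's inequality `27 a³ ≤ 64 D` forces `a = 1`.
  rw [← hg', ← hgr] at hmin hk2
  push Not at hba hlt
  have ha1 : a = 1 := by
    have e1 := mul_le_mul_of_nonneg_left hba ha.le
    have e2 := mul_le_mul_of_nonneg_left hlt hgpos.le
    exact eq_one_of_hermite_bounds (g := a * b' - t' ^ 2) hD ha (by linarith) (by linarith)
  refine ⟨a * b' - t' ^ 2, a * r'' - s' * t', a * c' - s' ^ 2, hgpos, ?_, hk', hlt,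
    fun x y z => ⟨x - l * (y - k * z) + t' * (y - k * z) + s' * z, y - k * z, z, ?_⟩⟩
  · rw [hmin, ha1]; ring
  · rw [hQ1, hQ2, ha1]; simp only [ternaryForm]; ring
termination_by (a.toNat, (a * b - t ^ 2).toNat)
decreasing_by
  · exact Prod.Lex.right _ (by omega)
  · exact Prod.Lex.left _ _ (by omega)

/-- Up to equivalence the sum of three squares is the only positive definite integral ternary form
of determinant `1`. -/
theorem ternaryForm_eq_of_det_one {a b c r s t : ℤ} (ha : 0 < a) (hg : 0 < a * b - t ^ 2)
    (hdet : a * b * c + 2 * r * s * t - a * r ^ 2 - b * s ^ 2 - c * t ^ 2 = 1) (x y z : ℤ) :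
    ∃ u v w : ℤ, ternaryForm a b c r s t x y z = u ^ 2 + v ^ 2 + w ^ 2 := by
  obtain ⟨β, ρ, γ, h1, h2, h3, h4, h5⟩ :=
    ternaryForm_reduction (by norm_num) a b c r s t ha hg hdet one_pos
  have h6 := four_mul_sq_le_of_two_mul_abs_le h3
  have hβ : β = 1 := by nlinarith
  subst hβ
  have hρ : ρ = 0 := by
    have := abs_nonneg ρ
    exact abs_eq_zero.1 (by omega)
  subst hρ
  obtain ⟨u, v, w, h⟩ := h5 x y z
  refine ⟨u, v, w, ?_⟩
  rw [h, show γ = 1 by linarith]; ring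

/-- A positive definite integral ternary form of determinant `3` is equivalent to `u² + v² + 3w²`
or to `u² + 2(v² ± v w + w²)`; the latter takes no value congruent to `5` modulo `8`. -/
theorem ternaryForm_eq_of_det_three {a b c r s t : ℤ} (ha : 0 < a) (hg : 0 < a * b - t ^ 2)
    (hdet : a * b * c + 2 * r * s * t - a * r ^ 2 - b * s ^ 2 - c * t ^ 2 = 3)
    {x₀ y₀ z₀ : ℤ} (h₀ : ternaryForm a b c r s t x₀ y₀ z₀ % 8 = 5) (x y z : ℤ) :
    ∃ u v w : ℤ, ternaryForm a b c r s t x y z = u ^ 2 + v ^ 2 + 3 * w ^ 2 := by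
  obtain ⟨β, ρ, γ, h1, h2, h3, h4, h5⟩ :=
    ternaryForm_reduction le_rfl a b c r s t ha hg hdet (by norm_num)
  have h6 := four_mul_sq_le_of_two_mul_abs_le h3
  have hβ : β ≤ 2 := by nlinarith
  obtain rfl | rfl : β = 1 ∨ β = 2 := by omega
  · have hρ : ρ = 0 := by
      have := abs_nonneg ρ
      exact abs_eq_zero.1 (by omega)
    subst hρ
    obtain ⟨u, v, w, h⟩ := h5 x y z
    refine ⟨u, v, w, ?_⟩
    rw [h, show γ = 3 by linarith]; ring
  · exfalso
    have hρ := abs_le.1 (show |ρ| ≤ 1 by omega)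
    obtain ⟨u, v, w, h⟩ := h5 x₀ y₀ z₀
    rw [h] at h₀
    obtain rfl | rfl | rfl : ρ = -1 ∨ ρ = 0 ∨ ρ = 1 := by omega
    · rw [show γ = 2 by linarith] at h₀
      have key : ∀ u v w : ZMod 8, u ^ 2 + 2 * v ^ 2 + 2 * (-1) * (v * w) + 2 * w ^ 2 ≠ 5 := by
        decide
      apply key u v w
      have := (ZMod.intCast_eq_intCast_iff _ _ 8).2 (show _ ≡ 5 [ZMOD 8] from h₀)
      push_cast at this
      exact this
    · omega
    · rw [show γ = 2 by linarith] at h₀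
      have key : ∀ u v w : ZMod 8, u ^ 2 + 2 * v ^ 2 + 2 * 1 * (v * w) + 2 * w ^ 2 ≠ 5 := by
        decide
      apply key u v w
      have := (ZMod.intCast_eq_intCast_iff _ _ 8).2 (show _ ≡ 5 [ZMOD 8] from h₀)
      push_cast at this
      exact this

theorem exists_prime_eq_add_mul {m a : ℕ} (hm : m ≠ 0) (h : a.Coprime m) :
    ∃ v, (a + m * v).Prime := by
  obtain ⟨p, hp, hprime, hmod⟩ := Nat.forall_exists_prime_gt_and_modEq a hm h
  obtain ⟨v, hv⟩ := (Nat.modEq_iff_dvd' hp.le).1 hmod.symm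
  refine ⟨v, ?_⟩
  rwa [← hv, Nat.add_sub_cancel' hp.le]

theorem exists_dvd_sq_sub {p : ℕ} (hp : p.Prime) {a : ℤ} (h : J(a | p) = 1) :
    ∃ r : ℤ, (p : ℤ) ∣ r ^ 2 - a := by
  have := Fact.mk hp
  obtain ⟨y, hy⟩ := ZMod.isSquare_of_jacobiSym_eq_one h
  obtain ⟨r, rfl⟩ := ZMod.intCast_surjective y
  refine ⟨r, (ZMod.intCast_zmod_eq_zero_iff_dvd _ _).1 ?_⟩
  push_cast
  rw [hy]; ring

theorem jacobiSym_eq_of_dvd_sub {a c : ℤ} {b : ℕ} (h : (b : ℤ) ∣ a - c) : J(a | b) = J(c | b) :=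
  
  jacobiSym.mod_left' (Int.emod_eq_emod_iff_emod_sub_eq_zero.2 (Int.emod_eq_zero_of_dvd h))

/-! ### Sums of three squares -/

/-- The form with Gram matrix `!![*, r, 1; r, q, 0; 1, 0, N]`, where the leading minor is `b`, has
determinant `N b - q = 1` and represents `N`. -/
theorem exists_sum_three_sq_of_dvd {N b q r : ℤ} (hq : 0 < q) (hb : 0 < b) (h : N * b = q + 1)
    (hr : q ∣ r ^ 2 + b) : ∃ u v w : ℤ, N = u ^ 2 + v ^ 2 + w ^ 2 := by
  obtain ⟨a, ha⟩ := hr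
  have ha0 : 0 < a := by
    have : 0 < q * a := by rw [← ha]; positivity
    exact pos_of_mul_pos_right this hq.le
  obtain ⟨u, v, w, huvw⟩ := ternaryForm_eq_of_det_one (a := a) (b := q) (c := N) (r := 0) (s := 1)
    (t := r) ha0 (by linarith) (by linear_combination (-N) * ha + h) 0 0 1
  refine ⟨u, v, w, ?_⟩
  rw [← huvw, ternaryForm]; ring

/-- For `N = 4j + 2` there is a prime `p = b N - 1` with `b ≡ 1 [MOD 4]` modulo which `-b` is a
square: as `p ≡ 1 [MOD 4]`, reciprocity gives `J(-b | p) = J(p | b) = J(-1 | b) = 1`. -/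
theorem exists_prime_jacobiSym_neg_eq_one (j : ℕ) :
    ∃ v p : ℕ, p.Prime ∧ p + 1 = (4 * v + 1) * (4 * j + 2) ∧ J(-((4 * v + 1 : ℕ) : ℤ) | p) = 1 := by
  obtain ⟨v, hv⟩ := exists_prime_eq_add_mul (m := 4 * (4 * j + 2)) (a := 4 * j + 1) (by positivity)
    (Nat.Coprime.mul_right (by simp)
      (Nat.isCoprime_iff_coprime.1 ⟨-1, 1, by push_cast; ring⟩))
  obtain ⟨p, hp⟩ : ∃ p, p = 4 * j + 1 + 4 * (4 * j + 2) * v := ⟨_, rfl⟩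
  rw [← hp] at hv
  have hp4 : p % 4 = 1 := by rw [hp, mul_assoc]; omega
  have hpb : p + 1 = (4 * v + 1) * (4 * j + 2) := by rw [hp]; ring
  refine ⟨v, p, hv, hpb, ?_⟩
  have hpo : Odd p := Nat.odd_iff.2 (by omega)
  have hbo : Odd (4 * v + 1) := Nat.odd_iff.2 (by omega)
  rw [jacobiSym.neg _ hpo, ZMod.χ₄_nat_one_mod_four hp4, one_mul,
    jacobiSym.quadratic_reciprocity_one_mod_four (by omega) hpo,
    jacobiSym_eq_of_dvd_sub (c := -1) ?_, jacobiSym.at_neg_one hbo,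
    ZMod.χ₄_nat_one_mod_four (by omega)]
  exact ⟨4 * j + 2, by zify at hpb; push_cast at hpb ⊢; linarith⟩

theorem exists_sum_three_sq_of_mod_four_eq_two {N : ℕ} (hN : N % 4 = 2) :
    ∃ u v w : ℤ, (N : ℤ) = u ^ 2 + v ^ 2 + w ^ 2 := by
  obtain ⟨v, p, hp, hpb, hJ⟩ := exists_prime_jacobiSym_neg_eq_one (N / 4)
  obtain ⟨r, hr⟩ := exists_dvd_sq_sub hp hJ
  rw [show 4 * (N / 4) + 2 = N by omega] at hpb
  refine exists_sum_three_sq_of_dvd (b := (4 * v + 1 : ℕ)) (q := p) (r := r)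
    (mod_cast hp.pos) (by positivity) ?_ (by rwa [sub_neg_eq_add] at hr)
  zify at hpb
  push_cast at hpb ⊢
  linarith

theorem exists_sum_three_sq_of_mod_four_eq_one {N : ℕ} (hN : N % 4 = 1) :
    ∃ u v w : ℤ, (N : ℤ) = u ^ 2 + v ^ 2 + w ^ 2 := by
  obtain ⟨v, p, hp, hpb, hJ⟩ := exists_prime_jacobiSym_neg_eq_one (N / 2)
  rw [show 4 * (N / 2) + 2 = 2 * N by omega] at hpb
  have hp8 : p % 8 = 1 := by
    have h1 : (4 * v + 1) * (2 * N) = 8 * (v * N) + 2 * N := by ring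
    omega
  -- As `p ≡ 1 [MOD 8]`, also `-2 b` is a square modulo the prime `p = b (2 N) - 1`.
  have hJ2 : J(-((2 * (4 * v + 1) : ℕ) : ℤ) | p) = 1 := by
    rw [Nat.cast_mul, ← mul_neg, jacobiSym.mul_left, hJ, mul_one, Nat.cast_ofNat,
      jacobiSym.at_two (Nat.odd_iff.2 (by omega)), ZMod.χ₈_nat_eq_if_mod_eight]
    simp [hp8, show p % 2 = 1 by omega]
  obtain ⟨r, hr⟩ := exists_dvd_sq_sub hp hJ2
  refine exists_sum_three_sq_of_dvd (b := (2 * (4 * v + 1) : ℕ)) (q := p) (r := r)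
    (mod_cast hp.pos) (by positivity) ?_ (by rwa [sub_neg_eq_add] at hr)
  zify at hpb
  push_cast at hpb ⊢
  linarith

theorem exists_sum_three_sq_of_mod_eight_eq_three {N : ℕ} (hN : N % 8 = 3) :
    ∃ u v w : ℤ, (N : ℤ) = u ^ 2 + v ^ 2 + w ^ 2 := by
  obtain ⟨j, rfl⟩ : ∃ j, N = 8 * j + 3 := ⟨N / 8, by omega⟩
  obtain ⟨v, hv⟩ := exists_prime_eq_add_mul (m := 4 * (8 * j + 3)) (a := 4 * j + 1) (by positivity)
    (Nat.Coprime.mul_right (by simp)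
      (Nat.isCoprime_iff_coprime.1 ⟨-2, 1, by push_cast; ring⟩))
  obtain ⟨p, hp⟩ : ∃ p, p = 4 * j + 1 + 4 * (8 * j + 3) * v := ⟨_, rfl⟩
  rw [← hp] at hv
  have hp4 : p % 4 = 1 := by rw [hp, mul_assoc]; omega
  have hpo : Odd p := Nat.odd_iff.2 (by omega)
  have hpb : (2 * p + 1 : ℤ) = (8 * v + 1 : ℕ) * (8 * j + 3) := by rw [hp]; push_cast; ring
  have hbo : Odd (8 * v + 1) := Nat.odd_iff.2 (by omega)
  have hJp : J((p : ℤ) | 8 * v + 1) = 1 := by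
    have h1 : J((2 * p : ℤ) | 8 * v + 1) = J(-1 | 8 * v + 1) :=
      jacobiSym_eq_of_dvd_sub ⟨8 * j + 3, by linarith⟩
    rwa [jacobiSym.mul_left, jacobiSym.at_two hbo, jacobiSym.at_neg_one hbo,
      ZMod.χ₄_nat_one_mod_four (by omega), ZMod.χ₈_nat_eq_if_mod_eight, if_neg (by omega),
      if_pos (by omega), one_mul] at h1
  have hJ : J(-((8 * v + 1 : ℕ) : ℤ) | p) = 1 := by
    rw [jacobiSym.neg _ hpo, ZMod.χ₄_nat_one_mod_four hp4, one_mul,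
      jacobiSym.quadratic_reciprocity_one_mod_four (by omega) hpo, hJp]
  obtain ⟨r, hr⟩ := exists_dvd_sq_sub hv hJ
  rw [sub_neg_eq_add] at hr
  -- A root modulo `p` can be taken odd, and then it is a root modulo `2 p`.
  obtain ⟨r', hr', hro⟩ : ∃ r' : ℤ, (p : ℤ) ∣ r' ^ 2 + (8 * v + 1 : ℕ) ∧ Odd r' := by
    rcases Int.even_or_odd r with he | ho
    · refine ⟨r + p, ?_, he.add_odd (mod_cast hpo)⟩
      have : (r + p) ^ 2 + (8 * v + 1 : ℕ) = r ^ 2 + (8 * v + 1 : ℕ) + p * (2 * r + p) := by ring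
      rw [this]
      exact dvd_add hr (dvd_mul_right _ _)
    · exact ⟨r, hr, ho⟩
  have h2 : (2 : ℤ) ∣ r' ^ 2 + (8 * v + 1 : ℕ) :=
    (hro.pow.add_odd (mod_cast hbo)).two_dvd
  have hcop : IsCoprime (2 : ℤ) p :=
    mod_cast Nat.isCoprime_iff_coprime.2 (Nat.coprime_two_left.2 hpo)
  refine exists_sum_three_sq_of_dvd (b := (8 * v + 1 : ℕ)) (q := 2 * p) (r := r')
    (by have := hv.pos; positivity) (by positivity) ?_ (hcop.mul_dvd h2 hr')
  push_cast at hpb ⊢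
  linarith

/-! ### The form `x² + y² + 3z²` -/

/-- The form with Gram matrix `!![4e, 2h, t; 2h, p, 0; t, 0, N]`, where `p e = h² + b`, has
determinant `4 N b - t² p = 3`, represents `N`, and takes at `(1, 1, 0)` a value congruent to `5`
modulo `8`. -/
theorem exists_sq_add_sq_add_three_mul_sq_of_dvd {N b p t h : ℤ} (hp : 0 < p) (hb : 0 < b)
    (hp8 : p % 8 = 1) (hbo : Odd b) (hN : 4 * N * b = t ^ 2 * p + 3) (hh : p ∣ h ^ 2 + b) :
    ∃ u v w : ℤ, N = u ^ 2 + v ^ 2 + 3 * w ^ 2 := by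
  obtain ⟨e, he⟩ := hh
  have he0 : 0 < e := by
    have : 0 < p * e := by rw [← he]; positivity
    exact pos_of_mul_pos_right this hp.le
  have hodd : (e + h) % 2 = 1 := by
    have h1 : p * e = 8 * (p / 8 * e) + e := by
      conv_lhs => rw [← Int.mul_ediv_add_emod p 8, hp8]
      ring
    have h2 : h ^ 2 % 2 = h % 2 := by
      rcases Int.emod_two_eq_zero_or_one h with h0 | h0 <;> simp [pow_two, Int.mul_emod, h0]
    rw [Int.odd_iff] at hbo
    omega
  obtain ⟨u, v, w, huvw⟩ := ternaryForm_eq_of_det_three (a := 4 * e) (b := p) (c := N) (r := 0)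
    (s := t) (t := 2 * h) (by linarith) (by linarith)
    (by linear_combination (-4 * N) * he + hN) (x₀ := 1) (y₀ := 1) (z₀ := 0)
    (by rw [ternaryForm]; omega) 0 0 1
  refine ⟨u, v, w, ?_⟩
  rw [← huvw, ternaryForm]; ring

theorem jacobiSym_neg_three_eq_one {b : ℕ} (hb : b % 6 = 1) : J(-3 | b) = 1 := by
  have hbo : Odd b := Nat.odd_iff.2 (by omega)
  have h3 : J((b : ℤ) | 3) = 1 := by
    rw [jacobiSym_eq_of_dvd_sub (c := 1) (by omega), jacobiSym.one_left]
  rw [jacobiSym.neg _ hbo]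
  rcases (by omega : b % 4 = 1 ∨ b % 4 = 3) with h | h
  · rw [ZMod.χ₄_nat_one_mod_four h, one_mul]
    exact (jacobiSym.quadratic_reciprocity_one_mod_four' (a := 3) (by decide) h).trans h3
  · rw [ZMod.χ₄_nat_three_mod_four h]
    have := jacobiSym.quadratic_reciprocity_three_mod_four (a := 3) (by decide) h
    rw [h3] at this
    push_cast at this
    rw [this]; norm_num

theorem exists_dvd_sq_add_of_mod_eight {p b : ℕ} (hp : p.Prime) (hp8 : p % 8 = 1) (hbo : Odd b)
    (hJ : J((p : ℤ) | b) = 1) : ∃ h : ℤ, (p : ℤ) ∣ h ^ 2 + b := by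
  have hpo : Odd p := Nat.odd_iff.2 (by omega)
  have : J(-(b : ℤ) | p) = 1 := by
    rw [jacobiSym.neg _ hpo, ZMod.χ₄_nat_one_mod_four (by omega), one_mul,
      jacobiSym.quadratic_reciprocity_one_mod_four' hbo (by omega), hJ]
  obtain ⟨h, hh⟩ := exists_dvd_sq_sub hp this
  exact ⟨h, by simpa using hh⟩

/-- Take a prime `p = 4 N b - 3` with `b ≡ 1 [MOD 6]`, so that `J(p | b) = J(-3 | b) = 1`. -/
theorem exists_sq_add_sq_add_three_mul_sq_of_not_three_dvd {N : ℕ} (hN : N % 2 = 1)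
    (h3 : N % 3 ≠ 0) : ∃ u v w : ℤ, (N : ℤ) = u ^ 2 + v ^ 2 + 3 * w ^ 2 := by
  have hc3 : (4 * N - 3).Coprime 3 :=
    ((Nat.Prime.coprime_iff_not_dvd Nat.prime_three).2 (by omega)).symm
  have hc2 : (4 * N - 3).Coprime 8 := by
    have : (4 * N - 3).Coprime 2 := Nat.coprime_two_right.2 (Nat.odd_iff.2 (by omega))
    exact this.pow_right 3
  have hcN : (4 * N - 3).Coprime N := by
    have h4 : N.Coprime 3 := ((Nat.Prime.coprime_iff_not_dvd Nat.prime_three).2 (by omega)).symm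
    refine Nat.dvd_one.1 (h4 ▸ Nat.dvd_gcd (Nat.gcd_dvd_right _ _) ?_)
    have h5 := Nat.dvd_sub ((Nat.gcd_dvd_right (4 * N - 3) N).mul_left 4) (Nat.gcd_dvd_left _ _)
    rwa [show 4 * N - (4 * N - 3) = 3 by omega] at h5
  obtain ⟨v, hv⟩ := exists_prime_eq_add_mul (m := 3 * 8 * N) (a := 4 * N - 3) (by omega)
    ((hc3.mul_right hc2).mul_right hcN)
  obtain ⟨p, hp⟩ : ∃ p, p = 4 * N - 3 + 3 * 8 * N * v := ⟨_, rfl⟩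
  rw [← hp] at hv
  have hp8 : p % 8 = 1 := by
    have : 3 * 8 * N * v = 8 * (3 * N * v) := by ring
    omega
  have hpb : (p : ℤ) + 3 = (6 * v + 1 : ℕ) * (4 * N) := by
    have : p + 3 = (6 * v + 1) * (4 * N) := by
      have h1 : 3 * 8 * N * v + 4 * N = (6 * v + 1) * (4 * N) := by ring
      omega
    exact_mod_cast this
  have hbo : Odd (6 * v + 1) := Nat.odd_iff.2 (by omega)
  have hJ : J((p : ℤ) | 6 * v + 1) = 1 := by
    rw [jacobiSym_eq_of_dvd_sub (c := -3) ⟨4 * N, by linarith⟩,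
      jacobiSym_neg_three_eq_one (by omega)]
  obtain ⟨h, hh⟩ := exists_dvd_sq_add_of_mod_eight hv hp8 hbo hJ
  exact exists_sq_add_sq_add_three_mul_sq_of_dvd (b := (6 * v + 1 : ℕ)) (p := p) (t := 1) (h := h)
    (mod_cast hv.pos) (by positivity) (by omega) (mod_cast hbo) (by linarith) hh

/-- For `N = 3 M` with `M ≡ 1 [MOD 3]`, take a prime `p` with `3 p = 4 M b - 1` and `b ≡ 1 [MOD 6]`;
then `J(p | b) = J(-3 | b) J(-3 p | b) = 1`. -/
theorem exists_sq_add_sq_add_three_mul_sq_of_mod_nine {N : ℕ} (hN : N % 2 = 1)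
    (h9 : N % 9 = 3) : ∃ u v w : ℤ, (N : ℤ) = u ^ 2 + v ^ 2 + 3 * w ^ 2 := by
  obtain ⟨j, rfl⟩ : ∃ j, N = 3 * (6 * j + 1) := ⟨N / 18, by omega⟩
  obtain ⟨v, hv⟩ := exists_prime_eq_add_mul (m := 8 * (6 * j + 1)) (a := 8 * j + 1) (by positivity)
    (Nat.Coprime.mul_right (by simp)
      (Nat.isCoprime_iff_coprime.1 ⟨-3, 4, by push_cast; ring⟩))
  obtain ⟨p, hp⟩ : ∃ p, p = 8 * j + 1 + 8 * (6 * j + 1) * v := ⟨_, rfl⟩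
  rw [← hp] at hv
  have hp8 : p % 8 = 1 := by rw [hp, mul_assoc]; omega
  have hpb : 3 * (p : ℤ) + 1 = (6 * v + 1 : ℕ) * (4 * (6 * j + 1)) := by
    rw [hp]; push_cast; ring
  have hbo : Odd (6 * v + 1) := Nat.odd_iff.2 (by omega)
  have hJ : J((p : ℤ) | 6 * v + 1) = 1 := by
    have h1 : J(-3 * p | 6 * v + 1) = J(1 | 6 * v + 1) :=
      jacobiSym_eq_of_dvd_sub ⟨-(4 * (6 * j + 1)), by linarith⟩
    rwa [jacobiSym.mul_left, jacobiSym_neg_three_eq_one (by omega), one_mul,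
      jacobiSym.one_left] at h1
  obtain ⟨h, hh⟩ := exists_dvd_sq_add_of_mod_eight hv hp8 hbo hJ
  refine exists_sq_add_sq_add_three_mul_sq_of_dvd (b := (6 * v + 1 : ℕ)) (p := p) (t := 3) (h := h)
    (mod_cast hv.pos) (by positivity) (by omega) (mod_cast hbo) ?_ hh
  push_cast at hpb ⊢
  linarith

/-! ### The values of a multiset of coefficients -/

/-- The set of values of `∑ c T_x`, where `c` runs through the multiset `M` of coefficients and the
arguments `x` are chosen independently. -/
def triangularValues (M : Multiset ℕ) : Set ℕ :=
  (M.map fun c => Set.range fun x => c * triangular x).sum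

theorem mem_triangularValues_zero {n : ℕ} : n ∈ triangularValues 0 ↔ n = 0 := by
  simp [triangularValues]

theorem mem_triangularValues_cons {c n : ℕ} {M : Multiset ℕ} :
    n ∈ triangularValues (c ::ₘ M) ↔
      ∃ x, ∃ m ∈ triangularValues M, c * triangular x + m = n := by
  simp [triangularValues, Set.mem_add]

theorem triangularValues_add (M M' : Multiset ℕ) :
    triangularValues (M + M') = triangularValues M + triangularValues M' := by
  simp [triangularValues]

theorem zero_mem_triangularValues (M : Multiset ℕ) : 0 ∈ triangularValues M := by
  induction M using Multiset.induction_on with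
  | empty => exact mem_triangularValues_zero.2 rfl
  | cons c M ih => exact mem_triangularValues_cons.2 ⟨0, 0, ih, by simp [triangular]⟩

theorem triangularValues_mono {M M' : Multiset ℕ} (h : M ≤ M') :
    triangularValues M ⊆ triangularValues M' := by
  obtain ⟨s, rfl⟩ := Multiset.le_iff_exists_add.1 h
  intro n hn
  rw [triangularValues_add]
  exact ⟨n, hn, 0, zero_mem_triangularValues s, add_zero n⟩

theorem exists_triangularSum_eq_iff {k : ℕ} (b : Fin k → ℕ) (n : ℕ) :
    (∃ x, triangularSum b x = n) ↔ n ∈ triangularValues (Finset.univ.val.map b) := by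
  rw [triangularValues, Multiset.map_map]
  change _ ↔ n ∈ ∑ i : Fin k, Set.range fun x => b i * triangular x
  rw [Set.mem_finsetSum]
  constructor
  · rintro ⟨x, rfl⟩
    exact ⟨fun i => b i * triangular (x i), fun _ => ⟨x _, rfl⟩, rfl⟩
  · rintro ⟨g, hg, rfl⟩
    choose x hx using fun i => hg (Finset.mem_univ i)
    exact ⟨x, Finset.sum_congr rfl fun i _ => hx i⟩

theorem le_triangular (x : ℕ) : x ≤ triangular x := by
  rw [triangular, Nat.le_div_iff_mul_le two_pos]
  rcases x with _ | x
  · simp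
  · gcongr; omega

/-- A bounded search deciding whether `n` is a value of the list `l` of positive coefficients. -/
def isTriangularValue : List ℕ → ℕ → Bool
  | [], n => n == 0
  | c :: l, n => (List.range (n + 1)).any fun x =>
      decide (c * triangular x ≤ n) && isTriangularValue l (n - c * triangular x)

theorem mem_triangularValues_coe_iff {l : List ℕ} (hl : ∀ c ∈ l, 0 < c) {n : ℕ} :
    n ∈ triangularValues l ↔ isTriangularValue l n = true := by
  induction l generalizing n with
  | nil => simp [isTriangularValue, mem_triangularValues_zero]
  | cons c l ih =>
    rw [← Multiset.cons_coe, mem_triangularValues_cons]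
    simp only [isTriangularValue, List.any_eq_true, List.mem_range, Bool.and_eq_true,
      decide_eq_true_eq]
    have hc : 0 < c := hl c (by simp)
    constructor
    · rintro ⟨x, m, hm, rfl⟩
      have h1 := le_triangular x
      have h2 : triangular x ≤ c * triangular x := Nat.le_mul_of_pos_left _ hc
      refine ⟨x, by omega, by omega, ?_⟩
      rwa [Nat.add_sub_cancel_left, ← ih fun c hc => hl c (by simp [hc])]
    · rintro ⟨x, -, hx, h⟩
      exact ⟨x, _, (ih fun c hc => hl c (by simp [hc])).2 h, Nat.add_sub_cancel' hx⟩

/-- If all coefficients `c ≤ v` of `M` are multiples of `d`, then so is every value `v` of `M`. -/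
theorem dvd_of_mem_triangularValues {d v : ℕ} {M : Multiset ℕ} (hM : ∀ c ∈ M, c ≤ v → d ∣ c)
    (hv : v ∈ triangularValues M) : d ∣ v := by
  suffices h : ∀ n, (∀ c ∈ M, c ≤ n → d ∣ c) → ∀ v ≤ n, v ∈ triangularValues M → d ∣ v from
    h v hM v le_rfl hv
  clear hv hM v
  intro n hM
  induction M using Multiset.induction_on with
  | empty => rintro v - hv; simp [mem_triangularValues_zero.1 hv]
  | cons c M ih =>
    intro v hvn hv
    obtain ⟨x, m, hm, rfl⟩ := mem_triangularValues_cons.1 hv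
    refine dvd_add ?_ (ih (fun c hc => hM c (Multiset.mem_cons_of_mem hc)) m (by omega) hm)
    rcases Nat.eq_zero_or_pos (triangular x) with h | h
    · simp [h]
    · have h2 : c ≤ c * triangular x := Nat.le_mul_of_pos_right _ h
      exact (hM c (Multiset.mem_cons_self c M) (by omega)).mul_right _

/-- **Escalation.** If `M` contains `l` and represents `n`, but no `n - v` with `d ∣ v` is a value
of `l` alone, then `M` contains beyond `l` a further coefficient `c ≤ n` that is not a multiple of
`d`. With `d = 0` the hypothesis says that `l` does not represent `n`. -/
theorem exists_cons_le_of_mem_triangularValues {l : List ℕ} {M : Multiset ℕ} {n : ℕ} (d : ℕ)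
    (hl : (l : Multiset ℕ) ≤ M) (hn : n ∈ triangularValues M) (hpos : ∀ c ∈ l, 0 < c)
    (h : ∀ v ≤ n, d ∣ v → isTriangularValue l (n - v) = false) :
    ∃ c, ((c :: l : List ℕ) : Multiset ℕ) ≤ M ∧ c ≤ n ∧ ¬ d ∣ c := by
  obtain ⟨t, rfl⟩ := Multiset.le_iff_exists_add.1 hl
  rw [triangularValues_add] at hn
  obtain ⟨u, hu, v, hv, rfl⟩ := Set.mem_add.1 hn
  have hdv : ¬ d ∣ v := by
    intro hd
    have := h v (by omega) hd
    rw [Nat.add_sub_cancel, (mem_triangularValues_coe_iff hpos).1 hu] at this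
    exact absurd this (by simp)
  by_contra hcon
  push Not at hcon
  refine hdv (dvd_of_mem_triangularValues (fun c hc hcv => hcon c ?_ (by omega)) hv)
  rw [← Multiset.cons_coe, ← Multiset.singleton_add, add_comm]
  exact add_le_add_right (Multiset.singleton_le.2 hc) _

theorem eight_mul_triangular_add_one (x : ℕ) : 8 * triangular x + 1 = (2 * x + 1) ^ 2 := by
  have h := Nat.div_mul_cancel (Nat.even_mul_succ_self x).two_dvd
  rw [triangular]
  linarith [show (2 * x + 1) ^ 2 = 4 * (x * (x + 1)) + 1 by ring]

theorem exists_eight_mul_triangular_add_one {u : ℤ} (hu : u % 2 = 1) :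
    ∃ x : ℕ, u ^ 2 = 8 * (triangular x : ℤ) + 1 := by
  refine ⟨u.natAbs / 2, ?_⟩
  have h : 2 * (u.natAbs / 2) + 1 = u.natAbs := by omega
  have := eight_mul_triangular_add_one (u.natAbs / 2)
  rw [h] at this
  rw [← Int.natAbs_sq]
  exact_mod_cast this.symm

theorem triangular_three_mul_add_one (x : ℕ) : triangular (3 * x + 1) = 9 * triangular x + 1 := by
  have h1 := eight_mul_triangular_add_one x
  have h2 := eight_mul_triangular_add_one (3 * x + 1)
  have h3 : (2 * (3 * x + 1) + 1) ^ 2 = 9 * (2 * x + 1) ^ 2 := by ring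
  omega

/-- If `m` is a value, then so is `9 m + ∑ c`, because `9 T_x + 1 = T_{3 x + 1}`. -/
theorem nine_mul_add_sum_mem_triangularValues {M : Multiset ℕ} {m : ℕ}
    (hm : m ∈ triangularValues M) : 9 * m + M.sum ∈ triangularValues M := by
  induction M using Multiset.induction_on generalizing m with
  | empty => simpa [mem_triangularValues_zero] using hm
  | cons c M ih =>
    obtain ⟨x, m, hm', rfl⟩ := mem_triangularValues_cons.1 hm
    refine mem_triangularValues_cons.2 ⟨3 * x + 1, _, ih hm', ?_⟩
    rw [triangular_three_mul_add_one, Multiset.sum_cons]; ring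

/-- Values of a ternary sum of triangular numbers correspond, by completing the square, to values
of the diagonal form at odd arguments. -/
theorem mem_triangularValues_of_odd {p q r n : ℕ} {x y z : ℤ} (hx : x % 2 = 1) (hy : y % 2 = 1)
    (hz : z % 2 = 1) (h : p * x ^ 2 + q * y ^ 2 + r * z ^ 2 = 8 * (n : ℤ) + p + q + r) :
    n ∈ triangularValues [p, q, r] := by
  obtain ⟨i, hi⟩ := exists_eight_mul_triangular_add_one hx
  obtain ⟨j, hj⟩ := exists_eight_mul_triangular_add_one hy
  obtain ⟨k, hk⟩ := exists_eight_mul_triangular_add_one hz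
  simp only [← Multiset.cons_coe, mem_triangularValues_cons]
  refine ⟨i, _, ⟨j, _, ⟨k, 0, mem_triangularValues_zero.2 rfl, rfl⟩, rfl⟩, ?_⟩
  rw [hi, hj, hk] at h
  zify
  linarith

/-! ### Ternary sums of triangular numbers -/

theorem sq_emod_cases (x : ℤ) :
    x % 2 = 1 ∧ x ^ 2 % 8 = 1 ∨ x % 4 = 0 ∧ x ^ 2 % 16 = 0 ∨ x % 4 = 2 ∧ x ^ 2 % 32 = 4 := by
  obtain h | h | h : x % 2 = 1 ∨ x % 4 = 0 ∨ x % 4 = 2 := by omega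
  · refine Or.inl ⟨h, ?_⟩
    obtain ⟨k, rfl⟩ : ∃ k, x = 2 * k + 1 := ⟨x / 2, by omega⟩
    obtain ⟨j, hj⟩ := (Int.even_mul_succ_self k).two_dvd
    rw [show (2 * k + 1) ^ 2 = 4 * (k * (k + 1)) + 1 by ring, hj]; omega
  · refine Or.inr (Or.inl ⟨h, ?_⟩)
    obtain ⟨k, rfl⟩ := Int.dvd_of_emod_eq_zero h
    rw [mul_pow]; omega
  · refine Or.inr (Or.inr ⟨h, ?_⟩)
    obtain ⟨k, rfl⟩ : ∃ k, x = 4 * k + 2 := ⟨x / 4, by omega⟩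
    obtain ⟨j, hj⟩ := (Int.even_mul_succ_self k).two_dvd
    rw [show (4 * k + 2) ^ 2 = 16 * (k * (k + 1)) + 4 by ring, hj]; omega

/-- Where `x` and `z` are both even, the identity `4 (x² + 3z²) = (x + 3z)² + 3 (x - z)²` makes them
odd. -/
theorem exists_odd_sq_add_three_mul_sq {x z : ℤ} (h : (x ^ 2 + 3 * z ^ 2) % 8 = 4) :
    ∃ u w : ℤ, u % 2 = 1 ∧ w % 2 = 1 ∧ u ^ 2 + 3 * w ^ 2 = x ^ 2 + 3 * z ^ 2 := by
  have hx := sq_emod_cases x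
  have hz := sq_emod_cases z
  obtain h1 | ⟨h1, h2⟩ : (x % 2 = 1 ∧ z % 2 = 1) ∨ x % 2 = 0 ∧ z % 2 = 0 := by omega
  · exact ⟨x, z, h1.1, h1.2, rfl⟩
  · obtain ⟨a, rfl⟩ := Int.dvd_of_emod_eq_zero h1
    obtain ⟨c, rfl⟩ := Int.dvd_of_emod_eq_zero h2
    exact ⟨a + 3 * c, a - c, by omega, by omega, by ring⟩

theorem exists_sum_three_sq_odd_odd_even {N : ℕ} (hN : N % 4 = 2) :
    ∃ a b c : ℤ, a % 2 = 1 ∧ b % 2 = 1 ∧ c % 2 = 0 ∧ (N : ℤ) = a ^ 2 + b ^ 2 + c ^ 2 := by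
  obtain ⟨u, v, w, h⟩ := exists_sum_three_sq_of_mod_four_eq_two hN
  have hu := sq_emod_cases u
  have hv := sq_emod_cases v
  have hw := sq_emod_cases w
  obtain h1 | h1 | h1 : (u % 2 = 1 ∧ v % 2 = 1 ∧ w % 2 = 0) ∨ (u % 2 = 1 ∧ v % 2 = 0 ∧ w % 2 = 1) ∨
    (u % 2 = 0 ∧ v % 2 = 1 ∧ w % 2 = 1) := by omega
  · exact ⟨u, v, w, h1.1, h1.2.1, h1.2.2, h⟩
  · exact ⟨u, w, v, h1.1, h1.2.2, h1.2.1, by linarith⟩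
  · exact ⟨v, w, u, h1.2.1, h1.2.2, h1.1, by linarith⟩

theorem mem_triangularValues_one_one_one (n : ℕ) : n ∈ triangularValues [1, 1, 1] := by
  obtain ⟨u, v, w, h⟩ := exists_sum_three_sq_of_mod_eight_eq_three (N := 8 * n + 3) (by omega)
  have hu := sq_emod_cases u
  have hv := sq_emod_cases v
  have hw := sq_emod_cases w
  push_cast at h
  exact mem_triangularValues_of_odd (x := u) (y := v) (z := w) (by omega) (by omega) (by omega)
    (by push_cast; linarith)

theorem mem_triangularValues_two_one_one (n : ℕ) : n ∈ triangularValues [2, 1, 1] := by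
  obtain ⟨a, b, c, ha, hb, hc, h⟩ := exists_sum_three_sq_odd_odd_even (N := 4 * n + 2) (by omega)
  push_cast at h
  exact mem_triangularValues_of_odd (x := a) (y := b + c) (z := b - c) (by omega) (by omega)
    (by omega) (by push_cast; linarith)

theorem mem_triangularValues_four_one_one (n : ℕ) : n ∈ triangularValues [4, 1, 1] := by
  obtain ⟨a, b, c, ha, hb, hc, h⟩ := exists_sum_three_sq_odd_odd_even (N := 8 * n + 6) (by omega)
  obtain ⟨d, rfl⟩ := Int.dvd_of_emod_eq_zero hc
  have h1 := sq_emod_cases a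
  have h2 := sq_emod_cases b
  have h3 := sq_emod_cases (2 * d)
  push_cast at h
  exact mem_triangularValues_of_odd (x := d) (y := a) (z := b) (by omega) (by omega)
    (by omega) (by push_cast; linarith)

theorem exists_sum_three_sq_odd_even_even {N : ℕ} (hN : N % 4 = 1) :
    ∃ a b c : ℤ, a % 2 = 1 ∧ b % 2 = 0 ∧ c % 2 = 0 ∧ (N : ℤ) = a ^ 2 + b ^ 2 + c ^ 2 := by
  obtain ⟨u, v, w, h⟩ := exists_sum_three_sq_of_mod_four_eq_one hN
  have hu := sq_emod_cases u
  have hv := sq_emod_cases v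
  have hw := sq_emod_cases w
  obtain h1 | h1 | h1 : (u % 2 = 1 ∧ v % 2 = 0 ∧ w % 2 = 0) ∨ (u % 2 = 0 ∧ v % 2 = 1 ∧ w % 2 = 0) ∨
    (u % 2 = 0 ∧ v % 2 = 0 ∧ w % 2 = 1) := by omega
  · exact ⟨u, v, w, h1.1, h1.2.1, h1.2.2, h⟩
  · exact ⟨v, u, w, h1.2.1, h1.1, h1.2.2, by linarith⟩
  · exact ⟨w, u, v, h1.2.2, h1.1, h1.2.1, by linarith⟩

theorem mem_triangularValues_two_two_one (n : ℕ) : n ∈ triangularValues [2, 2, 1] := by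
  obtain ⟨a, b, c, ha, hb, hc, h⟩ := exists_sum_three_sq_odd_even_even (N := 8 * n + 5) (by omega)
  obtain ⟨d, rfl⟩ := Int.dvd_of_emod_eq_zero hb
  obtain ⟨e, rfl⟩ := Int.dvd_of_emod_eq_zero hc
  have h1 := sq_emod_cases a
  have h2 := sq_emod_cases (2 * d)
  have h3 := sq_emod_cases (2 * e)
  push_cast at h
  exact mem_triangularValues_of_odd (x := d + e) (y := d - e) (z := a) (by omega) (by omega)
    (by omega) (by push_cast; linarith)

theorem mem_triangularValues_four_two_one (n : ℕ) : n ∈ triangularValues [4, 2, 1] := by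
  obtain ⟨a, b, c, ha, hb, hc, h⟩ := exists_sum_three_sq_odd_odd_even (N := 16 * n + 14) (by omega)
  obtain ⟨y, rfl⟩ := Int.dvd_of_emod_eq_zero hc
  -- Choosing the sign of `b`, write `b = a - 4 z`; then `a² + b² = 2 (a - 2 z)² + 8 z²`.
  obtain ⟨z, hz⟩ : ∃ z, b ^ 2 = (a - 4 * z) ^ 2 := by
    obtain h1 | h1 : (a - b) % 4 = 0 ∨ (a + b) % 4 = 0 := by omega
    · exact ⟨(a - b) / 4, by rw [show a - 4 * ((a - b) / 4) = b by omega]⟩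
    · exact ⟨(a + b) / 4, by rw [show a - 4 * ((a + b) / 4) = -b by omega, neg_sq]⟩
  have h1 := sq_emod_cases a
  have h2 := sq_emod_cases b
  have h3 := sq_emod_cases (2 * y)
  have h4 := sq_emod_cases y
  have h5 := sq_emod_cases (a - 2 * z)
  have h6 := sq_emod_cases z
  push_cast at h
  have key : 4 * z ^ 2 + 2 * y ^ 2 + (a - 2 * z) ^ 2 = 8 * (n : ℤ) + 7 := by linarith
  exact mem_triangularValues_of_odd (x := z) (y := y) (z := a - 2 * z) (by omega) (by omega)
    (by omega) (by push_cast; linarith)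

/-- A vector `(a, b, c)` with `5 ∣ a² + b² + c²` lies, up to permutations and signs, in the lattice
given by `5 ∣ c` and `5 ∣ a + 2b`, on which the sum of squares is `5 (5x² + y² + z²)`. -/
theorem exists_eq_five_mul_of_sum_three_sq {a b c : ℤ} (h : (a ^ 2 + b ^ 2 + c ^ 2) % 5 = 0)
    (ha : a % 2 = 1) (hb : b % 2 = 1) (hc : c % 2 = 1) :
    ∃ x y z : ℤ, x % 2 = 1 ∧ y % 2 = 1 ∧ z % 2 = 1 ∧
      a ^ 2 + b ^ 2 + c ^ 2 = 5 * (5 * x ^ 2 + y ^ 2 + z ^ 2) := by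
  -- The case `5 ∣ c` with the sign of `a` chosen such that `a ≡ -2 b`.
  have aux : ∀ {a b c : ℤ}, c % 5 = 0 → (a + 2 * b) % 5 = 0 → a % 2 = 1 → b % 2 = 1 → c % 2 = 1 →
      ∃ x y z : ℤ, x % 2 = 1 ∧ y % 2 = 1 ∧ z % 2 = 1 ∧
        a ^ 2 + b ^ 2 + c ^ 2 = 5 * (5 * x ^ 2 + y ^ 2 + z ^ 2) := by
    intro a b c h1 h2 ha hb hc
    obtain ⟨x, rfl⟩ := Int.dvd_of_emod_eq_zero h1
    obtain ⟨y, hy⟩ := Int.dvd_of_emod_eq_zero h2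
    obtain rfl : a = 5 * y - 2 * b := by linarith
    exact ⟨x, y, 2 * y - b, by omega, by omega, by omega, by ring⟩
  have aux' : ∀ {a b c : ℤ}, c % 5 = 0 → (a + 2 * b) % 5 = 0 ∨ (a - 2 * b) % 5 = 0 →
      a % 2 = 1 → b % 2 = 1 → c % 2 = 1 →
      ∃ x y z : ℤ, x % 2 = 1 ∧ y % 2 = 1 ∧ z % 2 = 1 ∧
        a ^ 2 + b ^ 2 + c ^ 2 = 5 * (5 * x ^ 2 + y ^ 2 + z ^ 2) := by
    intro a b c h1 h2 ha hb hc
    rcases h2 with h2 | h2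
    · exact aux h1 h2 ha hb hc
    · rw [← neg_sq a]
      exact aux h1 (by omega) (by omega) hb hc
  have sq5 : ∀ x : ℤ, x ^ 2 % 5 = (x % 5) ^ 2 % 5 := fun x => by rw [pow_two, pow_two, Int.mul_emod]
  have cases5 : ∀ x : ℤ, x % 5 = 0 ∧ x ^ 2 % 5 = 0 ∨ x % 5 = 1 ∧ x ^ 2 % 5 = 1 ∨
      x % 5 = 2 ∧ x ^ 2 % 5 = 4 ∨ x % 5 = 3 ∧ x ^ 2 % 5 = 4 ∨ x % 5 = 4 ∧ x ^ 2 % 5 = 1 := by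
    intro x
    have h1 := sq5 x
    obtain h | h | h | h | h : x % 5 = 0 ∨ x % 5 = 1 ∨ x % 5 = 2 ∨ x % 5 = 3 ∨ x % 5 = 4 := by omega
    all_goals rw [h] at h1; norm_num at h1; omega
  have h1 := cases5 a
  have h2 := cases5 b
  have h3 := cases5 c
  obtain h0 | h0 | h0 : c % 5 = 0 ∨ b % 5 = 0 ∨ a % 5 = 0 := by omega
  · exact aux' h0 (by omega) ha hb hc
  · rw [add_right_comm]
    exact aux' h0 (by omega) ha hc hb
  · rw [add_comm (a ^ 2), add_right_comm]
    exact aux' h0 (by omega) hb hc ha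

theorem mem_triangularValues_five_one_one (n : ℕ) : n ∈ triangularValues [5, 1, 1] := by
  obtain ⟨u, v, w, h⟩ :=
    exists_sum_three_sq_of_mod_eight_eq_three (N := 5 * (8 * n + 7)) (by omega)
  have hu := sq_emod_cases u
  have hv := sq_emod_cases v
  have hw := sq_emod_cases w
  push_cast at h
  obtain ⟨x, y, z, hx, hy, hz, hxyz⟩ :=
    exists_eq_five_mul_of_sum_three_sq (a := u) (b := v) (c := w) (by omega) (by omega) (by omega) (by omega)
  exact mem_triangularValues_of_odd hx hy hz (by push_cast; linarith)

/-- Adjust the signs in `a² + b² + c² = 12 n + 9` to make `a ≡ b ≡ c` modulo `3`, and use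
`2 (a² + b² + c²) / 3 = x² + 2y² + 3z²` with `3x = a + b - 2c`, `3y = a + b + c`, `3z = a - b`. -/
theorem mem_triangularValues_three_two_one (n : ℕ) : n ∈ triangularValues [3, 2, 1] := by
  obtain ⟨a, b, c, h⟩ := exists_sum_three_sq_of_mod_four_eq_one (N := 12 * n + 9) (by omega)
  push_cast at h
  have cases3 : ∀ x : ℤ, x % 3 = 0 ∧ x ^ 2 % 3 = 0 ∨ (x % 3 = 1 ∨ x % 3 = 2) ∧ x ^ 2 % 3 = 1 := by
    intro x
    have h1 : x ^ 2 % 3 = (x % 3) ^ 2 % 3 := by rw [pow_two, pow_two, Int.mul_emod]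
    obtain h | h | h : x % 3 = 0 ∨ x % 3 = 1 ∨ x % 3 = 2 := by omega
    all_goals rw [h] at h1; norm_num at h1; omega
  have sign3 : ∀ x : ℤ, ∃ x' : ℤ, x' ^ 2 = x ^ 2 ∧ x' % 3 = x ^ 2 % 3 := by
    intro x
    have h1 := cases3 x
    obtain h | h : x % 3 = x ^ 2 % 3 ∨ (-x) % 3 = x ^ 2 % 3 := by omega
    · exact ⟨x, rfl, h⟩
    · exact ⟨-x, neg_sq x, h⟩
  obtain ⟨a', ha, ha3⟩ := sign3 a
  obtain ⟨b', hb, hb3⟩ := sign3 b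
  obtain ⟨c', hc, hc3⟩ := sign3 c
  have h1 := cases3 a
  have h2 := cases3 b
  have h3 := cases3 c
  obtain ⟨z, hz⟩ : (3 : ℤ) ∣ a' - b' := by omega
  obtain ⟨y, hy⟩ : (3 : ℤ) ∣ a' + b' + c' := by omega
  rw [← ha, ← hb, ← hc] at h
  obtain rfl : b' = a' - 3 * z := by linarith
  obtain rfl : c' = 3 * y - 2 * a' + 3 * z := by linarith
  have key : (2 * a' - 3 * z - 2 * y) ^ 2 + 2 * y ^ 2 + 3 * z ^ 2 = 8 * (n : ℤ) + 6 := by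
    linarith
  have h4 := sq_emod_cases (2 * a' - 3 * z - 2 * y)
  have h5 := sq_emod_cases y
  have h6 := sq_emod_cases z
  obtain ⟨u, w, hu, hw, huw⟩ := exists_odd_sq_add_three_mul_sq (x := 2 * a' - 3 * z - 2 * y)
    (z := z) (by omega)
  exact mem_triangularValues_of_odd hw (by omega : y % 2 = 1) hu (by push_cast; linarith)

theorem mem_triangularValues_three_one_one_of_eq {n : ℕ} {u v w : ℤ}
    (h : 8 * (n : ℤ) + 5 = u ^ 2 + v ^ 2 + 3 * w ^ 2) : n ∈ triangularValues [3, 1, 1] := by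
  have hu := sq_emod_cases u
  have hv := sq_emod_cases v
  have hw := sq_emod_cases w
  obtain h1 | h1 : u % 2 = 1 ∧ (v ^ 2 + 3 * w ^ 2) % 8 = 4 ∨
    v % 2 = 1 ∧ (u ^ 2 + 3 * w ^ 2) % 8 = 4 := by omega
  · obtain ⟨x, z, hx, hz, hxz⟩ := exists_odd_sq_add_three_mul_sq h1.2
    exact mem_triangularValues_of_odd hz hx h1.1 (by push_cast; linarith)
  · obtain ⟨x, z, hx, hz, hxz⟩ := exists_odd_sq_add_three_mul_sq h1.2
    exact mem_triangularValues_of_odd hz hx h1.1 (by push_cast; linarith)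

theorem mem_triangularValues_two_three_two_of_eq {n : ℕ} {u v w : ℤ}
    (h : 8 * (n : ℤ) + 7 = u ^ 2 + v ^ 2 + 3 * w ^ 2) : n ∈ triangularValues [2, 3, 2] := by
  have hu := sq_emod_cases u
  have hv := sq_emod_cases v
  have hw := sq_emod_cases w
  obtain ⟨a, rfl⟩ : (2 : ℤ) ∣ u := by omega
  obtain ⟨b, rfl⟩ : (2 : ℤ) ∣ v := by omega
  exact mem_triangularValues_of_odd (x := a + b) (y := w) (z := a - b) (by omega) (by omega)
    (by omega) (by push_cast; linarith)

theorem mem_triangularValues_four_three_two_of_mem_curiousSet {n : ℕ} (h : n ∈ curiousSet) :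
    n ∈ triangularValues [4, 3, 2] := by
  obtain ⟨-, x, y, z, h⟩ := h
  have hx := sq_emod_cases x
  have hy := sq_emod_cases y
  have hz := sq_emod_cases z
  exact mem_triangularValues_of_odd (x := z) (y := y) (z := x) (by omega) (by omega) (by omega)
    (by push_cast; linarith)

/-! ### Sums of triangular numbers with coefficients `3, 1, 1` or `2, 3, 2` and one more -/

theorem mem_triangularValues_cons_of_mem {c n : ℕ} {l : List ℕ} (h : n ∈ triangularValues l) :
    n ∈ triangularValues (c :: l : List ℕ) :=
  mem_triangularValues_cons.2 ⟨0, n, h, by simp [triangular]⟩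

theorem mem_triangularValues_cons_of_sub {c n : ℕ} {l : List ℕ} (x : ℕ) (hn : c * triangular x ≤ n)
    (h : n - c * triangular x ∈ triangularValues l) : n ∈ triangularValues (c :: l : List ℕ) :=
  mem_triangularValues_cons.2 ⟨x, _, h, Nat.add_sub_cancel' hn⟩

theorem triangular_one : triangular 1 = 1 := rfl

theorem triangular_two : triangular 2 = 3 := rfl

theorem mem_triangularValues_three_one_one_of_mod_three {n : ℕ} (h : n % 3 ≠ 2) :
    n ∈ triangularValues [3, 1, 1] := by
  obtain ⟨u, v, w, huvw⟩ := exists_sq_add_sq_add_three_mul_sq_of_not_three_dvd (N := 8 * n + 5)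
    (by omega) (by omega)
  exact mem_triangularValues_three_one_one_of_eq (by exact_mod_cast huvw)

theorem mem_triangularValues_three_one_one_of_mod_nine {n : ℕ} (h : n % 9 = 2) :
    n ∈ triangularValues [3, 1, 1] := by
  obtain ⟨u, v, w, huvw⟩ := exists_sq_add_sq_add_three_mul_sq_of_mod_nine (N := 8 * n + 5)
    (by omega) (by omega)
  exact mem_triangularValues_three_one_one_of_eq (by exact_mod_cast huvw)

theorem nine_mul_add_five_mem_triangularValues {m : ℕ} (h : m ∈ triangularValues [3, 1, 1]) :
    9 * m + 5 ∈ triangularValues [3, 1, 1] :=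
  nine_mul_add_sum_mem_triangularValues h

theorem mem_triangularValues_two_three_two_of_mod_three {n : ℕ} (h : n % 3 ≠ 1) :
    n ∈ triangularValues [2, 3, 2] := by
  obtain ⟨u, v, w, huvw⟩ := exists_sq_add_sq_add_three_mul_sq_of_not_three_dvd (N := 8 * n + 7)
    (by omega) (by omega)
  exact mem_triangularValues_two_three_two_of_eq (by exact_mod_cast huvw)

theorem mem_triangularValues_two_three_two_of_mod_nine {n : ℕ} (h : n % 9 = 4) :
    n ∈ triangularValues [2, 3, 2] := by
  obtain ⟨u, v, w, huvw⟩ := exists_sq_add_sq_add_three_mul_sq_of_mod_nine (N := 8 * n + 7)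
    (by omega) (by omega)
  exact mem_triangularValues_two_three_two_of_eq (by exact_mod_cast huvw)

theorem nine_mul_add_seven_mem_triangularValues {m : ℕ} (h : m ∈ triangularValues [2, 3, 2]) :
    9 * m + 7 ∈ triangularValues [2, 3, 2] :=
  nine_mul_add_sum_mem_triangularValues h

theorem mem_triangularValues_three_one_one_of_lt {n : ℕ} (hn : n < 17) (h8 : n ≠ 8) :
    n ∈ triangularValues [3, 1, 1] := by
  by_cases h : n % 3 = 2
  · obtain h | h | h : n % 9 = 2 ∨ n = 9 * 0 + 5 ∨ n = 9 * 1 + 5 := by omega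
    · exact mem_triangularValues_three_one_one_of_mod_nine h
    all_goals
      rw [h]
      exact nine_mul_add_five_mem_triangularValues
        (mem_triangularValues_three_one_one_of_mod_three (by decide))
  · exact mem_triangularValues_three_one_one_of_mod_three h

theorem mem_triangularValues_cons_three_one_one {c n : ℕ} (hc : c ≤ 17) (hc3 : c % 3 ≠ 0)
    (h8 : n ≠ 8) : n ∈ triangularValues [c, 3, 1, 1] := by
  by_cases hn : n < 17
  · exact mem_triangularValues_cons_of_mem (mem_triangularValues_three_one_one_of_lt hn h8)
  by_cases h : n % 3 = 2
  · refine mem_triangularValues_cons_of_sub 1 (by rw [triangular_one]; omega)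
      (mem_triangularValues_three_one_one_of_mod_three ?_)
    rw [triangular_one]; omega
  · exact mem_triangularValues_cons_of_mem (mem_triangularValues_three_one_one_of_mod_three h)

theorem mem_triangularValues_three_three_one_one (n : ℕ) :
    n ∈ triangularValues [3, 3, 1, 1] := by
  induction n using Nat.strong_induction_on with
  | _ n ih =>
    obtain h | h | h : n % 3 ≠ 2 ∨ n % 9 = 2 ∨ n % 9 = 5 ∨ n % 9 = 8 := by omega
    · exact mem_triangularValues_cons_of_mem (mem_triangularValues_three_one_one_of_mod_three h)
    · exact mem_triangularValues_cons_of_mem (mem_triangularValues_three_one_one_of_mod_nine h)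
    obtain h | h := h
    · refine mem_triangularValues_cons_of_sub 1 (by rw [triangular_one]; omega)
        (mem_triangularValues_three_one_one_of_mod_nine ?_)
      rw [triangular_one]; omega
    · have := nine_mul_add_sum_mem_triangularValues (ih (n / 9) (by omega))
      rwa [Multiset.sum_coe, show 9 * (n / 9) + [3, 3, 1, 1].sum = n by simp; omega] at this

theorem mem_triangularValues_six_three_one_one (n : ℕ) :
    n ∈ triangularValues [6, 3, 1, 1] := by
  obtain h | h | h : n % 3 ≠ 2 ∨ n % 9 = 2 ∨ n % 9 = 5 ∨ n % 9 = 8 := by omega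
  · exact mem_triangularValues_cons_of_mem (mem_triangularValues_three_one_one_of_mod_three h)
  · exact mem_triangularValues_cons_of_mem (mem_triangularValues_three_one_one_of_mod_nine h)
  obtain h | h := h
  · by_cases hm : n / 9 % 3 = 2
    · refine mem_triangularValues_cons_of_sub 2 (by rw [triangular_two]; omega) ?_
      rw [triangular_two, show n - 6 * 3 = 9 * (n / 9 - 2) + 5 by omega]
      exact nine_mul_add_five_mem_triangularValues
        (mem_triangularValues_three_one_one_of_mod_three (by omega))
    · rw [show n = 9 * (n / 9) + 5 by omega]
      exact mem_triangularValues_cons_of_mem (nine_mul_add_five_mem_triangularValues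
        (mem_triangularValues_three_one_one_of_mod_three hm))
  · refine mem_triangularValues_cons_of_sub 1 (by rw [triangular_one]; omega)
      (mem_triangularValues_three_one_one_of_mod_nine ?_)
    rw [triangular_one]; omega

theorem mem_triangularValues_fifteen_three_one_one {n : ℕ} (h8 : n ≠ 8) :
    n ∈ triangularValues [15, 3, 1, 1] := by
  by_cases hn : n < 17
  · exact mem_triangularValues_cons_of_mem (mem_triangularValues_three_one_one_of_lt hn h8)
  obtain h | h | h : n % 3 ≠ 2 ∨ n % 9 = 2 ∨ n % 9 = 5 ∨ n % 9 = 8 := by omega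
  · exact mem_triangularValues_cons_of_mem (mem_triangularValues_three_one_one_of_mod_three h)
  · exact mem_triangularValues_cons_of_mem (mem_triangularValues_three_one_one_of_mod_nine h)
  obtain h | h := h
  · by_cases hm : n / 9 % 3 = 2
    · by_cases hm2 : n / 9 = 2
      · rw [show n = 9 * 2 + 5 by omega]
        exact mem_triangularValues_cons_of_mem (nine_mul_add_five_mem_triangularValues
          (mem_triangularValues_three_one_one_of_mod_nine rfl))
      refine mem_triangularValues_cons_of_sub 2 (by rw [triangular_two]; omega) ?_
      rw [triangular_two, show n - 15 * 3 = 9 * (n / 9 - 5) + 5 by omega]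
      exact nine_mul_add_five_mem_triangularValues
        (mem_triangularValues_three_one_one_of_mod_three (by omega))
    · rw [show n = 9 * (n / 9) + 5 by omega]
      exact mem_triangularValues_cons_of_mem (nine_mul_add_five_mem_triangularValues
        (mem_triangularValues_three_one_one_of_mod_three hm))
  · refine mem_triangularValues_cons_of_sub 1 (by rw [triangular_one]; omega)
      (mem_triangularValues_three_one_one_of_mod_nine ?_)
    rw [triangular_one]; omega

/-- The quaternary form `x² + y² + 3z² + 12w²` is anisotropic over `ℚ₃`, which creates the infinite
family of possible exceptions `8, 89, 818, …`. -/
theorem mem_triangularValues_twelve_three_one_one_or (n : ℕ) :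
    n ∈ triangularValues [12, 3, 1, 1] ∨ ∃ k, 8 * n + 17 = 9 ^ k := by
  induction n using Nat.strong_induction_on with
  | _ n ih =>
    obtain h | h | h : n % 3 ≠ 2 ∨ n % 9 = 2 ∨ n % 9 = 5 ∨ n % 9 = 8 := by omega
    · exact .inl (mem_triangularValues_cons_of_mem
        (mem_triangularValues_three_one_one_of_mod_three h))
    · exact .inl (mem_triangularValues_cons_of_mem
        (mem_triangularValues_three_one_one_of_mod_nine h))
    obtain h | h := h
    · left
      by_cases h17 : n < 17
      · exact mem_triangularValues_cons_of_mem
          (mem_triangularValues_three_one_one_of_lt h17 (by omega))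
      refine mem_triangularValues_cons_of_sub 1 (by rw [triangular_one]; omega)
        (mem_triangularValues_three_one_one_of_mod_nine ?_)
      rw [triangular_one]; omega
    · by_cases h8 : n = 8
      · exact .inr ⟨2, by rw [h8]; rfl⟩
      obtain h1 | ⟨k, hk⟩ := ih (n / 9 - 1) (by omega)
      · have := nine_mul_add_sum_mem_triangularValues h1
        rw [Multiset.sum_coe, show 9 * (n / 9 - 1) + [12, 3, 1, 1].sum = n by simp; omega] at this
        exact .inl this
      · exact .inr ⟨k + 1, by rw [pow_succ, ← hk]; omega⟩

/-- Two exceptions of `[12, 3, 1, 1]` beyond `89` differ by more than `89`. -/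
theorem mem_triangularValues_cons_twelve_three_one_one {d n : ℕ} (hd : d ≤ 89) (hd0 : 0 < d)
    (h8 : n ≠ 8) (h89 : n ≠ 89) : n ∈ triangularValues [d, 12, 3, 1, 1] := by
  obtain h | ⟨k, hk⟩ := mem_triangularValues_twelve_three_one_one_or n
  · exact mem_triangularValues_cons_of_mem h
  obtain ⟨j, rfl⟩ : ∃ j, k = j + 4 := by
    refine ⟨k - 4, ?_⟩
    by_contra hcon
    have : k < 4 := by omega
    interval_cases k <;> omega
  have h1 : 9 ^ (j + 4) = 9 * 9 ^ (j + 3) := by ring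
  have h2 : 9 ^ 3 ≤ 9 ^ (j + 3) := Nat.pow_le_pow_right (by norm_num) (by omega)
  obtain h | ⟨i, hi⟩ := mem_triangularValues_twelve_three_one_one_or (n - d)
  · exact mem_triangularValues_cons_of_sub 1 (by rw [triangular_one]; omega)
      (by rwa [triangular_one, mul_one])
  · exfalso
    have h3 : 9 ^ (j + 3) < 9 ^ i := by omega
    have h4 : 9 ^ i < 9 ^ (j + 4) := by omega
    have h5 := (Nat.pow_lt_pow_iff_right (by norm_num)).1 h3
    have h6 := (Nat.pow_lt_pow_iff_right (by norm_num)).1 h4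
    omega

theorem mem_triangularValues_cons_two_three_two {c n : ℕ} (hc : c ≤ 10) (hc3 : c % 3 ≠ 0)
    (h1 : n ≠ 1) : n ∈ triangularValues [c, 2, 3, 2] := by
  obtain h | h | h : n % 3 ≠ 1 ∨ n % 9 = 4 ∨ n = 7 ∨ 10 ≤ n ∧ n % 3 = 1 := by omega
  · exact mem_triangularValues_cons_of_mem (mem_triangularValues_two_three_two_of_mod_three h)
  · exact mem_triangularValues_cons_of_mem (mem_triangularValues_two_three_two_of_mod_nine h)
  obtain rfl | h := h
  · exact mem_triangularValues_cons_of_mem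
      (nine_mul_add_seven_mem_triangularValues (zero_mem_triangularValues _))
  · refine mem_triangularValues_cons_of_sub 1 (by rw [triangular_one]; omega)
      (mem_triangularValues_two_three_two_of_mod_three ?_)
    rw [triangular_one]; omega

theorem mem_triangularValues_six_two_three_two {n : ℕ} (h1 : n ≠ 1) (h16 : n ≠ 16) :
    n ∈ triangularValues [6, 2, 3, 2] := by
  obtain h | h | h : n % 3 ≠ 1 ∨ n % 9 = 4 ∨ n % 9 = 7 ∨ n % 9 = 1 := by omega
  · exact mem_triangularValues_cons_of_mem (mem_triangularValues_two_three_two_of_mod_three h)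
  · exact mem_triangularValues_cons_of_mem (mem_triangularValues_two_three_two_of_mod_nine h)
  obtain h | h := h
  · by_cases hm : n / 9 % 3 = 1
    · refine mem_triangularValues_cons_of_sub 2 (by rw [triangular_two]; omega) ?_
      rw [triangular_two, show n - 6 * 3 = 9 * (n / 9 - 2) + 7 by omega]
      exact nine_mul_add_seven_mem_triangularValues
        (mem_triangularValues_two_three_two_of_mod_three (by omega))
    · rw [show n = 9 * (n / 9) + 7 by omega]
      exact mem_triangularValues_cons_of_mem (nine_mul_add_seven_mem_triangularValues
        (mem_triangularValues_two_three_two_of_mod_three hm))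
  · refine mem_triangularValues_cons_of_sub 1 (by rw [triangular_one]; omega)
      (mem_triangularValues_two_three_two_of_mod_nine ?_)
    rw [triangular_one]; omega

/-- The quaternary form `2x² + 2y² + 3z² + 3w²` is anisotropic over `ℚ₃`, which creates the infinite
family of possible exceptions `1, 19, 181, …`. -/
theorem mem_triangularValues_three_two_three_two_or (n : ℕ) :
    n ∈ triangularValues [3, 2, 3, 2] ∨ ∃ k, 8 * n + 10 = 2 * 9 ^ k := by
  induction n using Nat.strong_induction_on with
  | _ n ih =>
    obtain h | h | h : n % 3 ≠ 1 ∨ n % 9 = 4 ∨ n % 9 = 7 ∨ n % 9 = 1 := by omega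
    · exact .inl (mem_triangularValues_cons_of_mem
        (mem_triangularValues_two_three_two_of_mod_three h))
    · exact .inl (mem_triangularValues_cons_of_mem
        (mem_triangularValues_two_three_two_of_mod_nine h))
    obtain h | h := h
    · left
      refine mem_triangularValues_cons_of_sub 1 (by rw [triangular_one]; omega)
        (mem_triangularValues_two_three_two_of_mod_nine ?_)
      rw [triangular_one]; omega
    · by_cases h1 : n = 1
      · exact .inr ⟨1, by rw [h1]; rfl⟩
      obtain h1 | ⟨k, hk⟩ := ih (n / 9 - 1) (by omega)
      · have := nine_mul_add_sum_mem_triangularValues h1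
        rw [Multiset.sum_coe, show 9 * (n / 9 - 1) + [3, 2, 3, 2].sum = n by simp; omega] at this
        exact .inl this
      · exact .inr ⟨k + 1, by rw [pow_succ, ← mul_assoc, ← hk]; omega⟩

/-- Two exceptions of `[3, 2, 3, 2]` beyond `19` differ by more than `19`. -/
theorem mem_triangularValues_cons_three_two_three_two {d n : ℕ} (hd : d ≤ 19) (hd0 : 0 < d)
    (hn1 : n ≠ 1) (h19 : n ≠ 19) : n ∈ triangularValues [d, 3, 2, 3, 2] := by
  obtain h | ⟨k, hk⟩ := mem_triangularValues_three_two_three_two_or n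
  · exact mem_triangularValues_cons_of_mem h
  obtain ⟨j, rfl⟩ : ∃ j, k = j + 3 := by
    refine ⟨k - 3, ?_⟩
    by_contra hcon
    have : k < 3 := by omega
    interval_cases k <;> omega
  have h1 : 9 ^ (j + 3) = 9 * 9 ^ (j + 2) := by ring
  have h2 : 9 ^ 2 ≤ 9 ^ (j + 2) := Nat.pow_le_pow_right (by norm_num) (by omega)
  obtain h | ⟨i, hi⟩ := mem_triangularValues_three_two_three_two_or (n - d)
  · exact mem_triangularValues_cons_of_sub 1 (by rw [triangular_one]; omega)
      (by rwa [triangular_one, mul_one])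
  · exfalso
    have h3 : 9 ^ (j + 2) < 9 ^ i := by omega
    have h4 : 9 ^ i < 9 ^ (j + 3) := by omega
    have h5 := (Nat.pow_lt_pow_iff_right (by norm_num)).1 h3
    have h6 := (Nat.pow_lt_pow_iff_right (by norm_num)).1 h4
    omega

/-! ### The escalation tree -/

/-- The conclusion for multisets containing `{1, 2}`, all of whose escalators are universal. -/
theorem mem_triangularValues_of_two_one_le {M : Multiset ℕ}
    (hM : (([2, 1] : List ℕ) : Multiset ℕ) ≤ M) (h4 : 4 ∈ triangularValues M) (n : ℕ) :
    n ∈ triangularValues M := by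
  obtain ⟨c, hle, hc, hc0⟩ :=
    exists_cons_le_of_mem_triangularValues 0 hM h4 (by simp) (by decide +kernel)
  apply triangularValues_mono hle
  rw [zero_dvd_iff] at hc0
  obtain rfl | rfl | rfl | rfl : c = 1 ∨ c = 2 ∨ c = 3 ∨ c = 4 := by omega
  · rw [show (([1, 2, 1] : List ℕ) : Multiset ℕ) = [2, 1, 1] by decide]
    exact mem_triangularValues_two_one_one n
  · exact mem_triangularValues_two_two_one n
  · exact mem_triangularValues_three_two_one n
  · exact mem_triangularValues_four_two_one n

/-- The conclusion for multisets containing `{1, 1}`. The coefficient `9` is excluded in the second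
escalation because neither `17` nor `17 - 9` is a value of `[3, 1, 1]`. -/
theorem mem_triangularValues_of_one_one_le {M : Multiset ℕ}
    (hM : (([1, 1] : List ℕ) : Multiset ℕ) ≤ M)
    (h5 : 5 ∈ triangularValues M) (h17 : 17 ∈ triangularValues M) (h89 : 89 ∈ triangularValues M)
    {n : ℕ} (hn : n ≠ 8) : n ∈ triangularValues M := by
  obtain ⟨c, hle, hc, hc0⟩ :=
    exists_cons_le_of_mem_triangularValues 0 hM h5 (by simp) (by decide +kernel)
  rw [zero_dvd_iff] at hc0
  obtain rfl | rfl | rfl | rfl | rfl : c = 1 ∨ c = 2 ∨ c = 4 ∨ c = 5 ∨ c = 3 := by omega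
  · exact triangularValues_mono hle (mem_triangularValues_one_one_one n)
  · exact triangularValues_mono hle (mem_triangularValues_two_one_one n)
  · exact triangularValues_mono hle (mem_triangularValues_four_one_one n)
  · exact triangularValues_mono hle (mem_triangularValues_five_one_one n)
  obtain ⟨c, hle, hc, hc9⟩ :=
    exists_cons_le_of_mem_triangularValues 9 hle h17 (by simp) (by decide +kernel)
  by_cases hc3 : c % 3 = 0
  · obtain rfl | rfl | rfl | rfl : c = 3 ∨ c = 6 ∨ c = 15 ∨ c = 12 := by omega
    · exact triangularValues_mono hle (mem_triangularValues_three_three_one_one n)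
    · exact triangularValues_mono hle (mem_triangularValues_six_three_one_one n)
    · exact triangularValues_mono hle (mem_triangularValues_fifteen_three_one_one hn)
    by_cases hn89 : n = 89
    · rwa [hn89]
    obtain ⟨d, hle, hd, hd0⟩ :=
      exists_cons_le_of_mem_triangularValues 0 hle h89 (by simp) (by decide +kernel)
    rw [zero_dvd_iff] at hd0
    exact triangularValues_mono hle
      (mem_triangularValues_cons_twelve_three_one_one hd (by omega) hn hn89)
  · exact triangularValues_mono hle (mem_triangularValues_cons_three_one_one hc hc3 hn)

/-- The conclusion for multisets containing `{2, 3}`. Further coefficients `3` do not help to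
represent `4`, and in the case `{2, 2, 3}` further coefficients `9` do not help to represent
`10`. -/
theorem mem_triangularValues_of_three_two_le {M : Multiset ℕ}
    (hM : (([3, 2] : List ℕ) : Multiset ℕ) ≤ M)
    (h4 : 4 ∈ triangularValues M) (h10 : 10 ∈ triangularValues M) (h16 : 16 ∈ triangularValues M)
    (h19 : 19 ∈ triangularValues M) {n : ℕ} (hn : n ≠ 1) (hn432 : n ∈ triangularValues [4, 3, 2]) :
    n ∈ triangularValues M := by
  obtain ⟨c, hle, hc, hc3⟩ :=
    exists_cons_le_of_mem_triangularValues 3 hM h4 (by simp) (by decide +kernel)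
  obtain rfl | rfl | rfl : c = 1 ∨ c = 4 ∨ c = 2 := by omega
  · rw [show (([1, 3, 2] : List ℕ) : Multiset ℕ) = [3, 2, 1] by decide] at hle
    exact triangularValues_mono hle (mem_triangularValues_three_two_one n)
  · exact triangularValues_mono hle hn432
  obtain ⟨c, hle, hc, hc9⟩ :=
    exists_cons_le_of_mem_triangularValues 9 hle h10 (by simp) (by decide +kernel)
  by_cases hc3 : c % 3 = 0
  · obtain rfl | rfl : c = 6 ∨ c = 3 := by omega
    · by_cases hn16 : n = 16
      · rwa [hn16]
      exact triangularValues_mono hle (mem_triangularValues_six_two_three_two hn hn16)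
    by_cases hn19 : n = 19
    · rwa [hn19]
    obtain ⟨d, hle, hd, hd0⟩ :=
      exists_cons_le_of_mem_triangularValues 0 hle h19 (by simp) (by decide +kernel)
    rw [zero_dvd_iff] at hd0
    exact triangularValues_mono hle
      (mem_triangularValues_cons_three_two_three_two hd (by omega) hn hn19)
  · exact triangularValues_mono hle (mem_triangularValues_cons_two_three_two hc hc3 hn)

theorem mem_triangularValues_of_mem_curiousSet {M : Multiset ℕ}
    (hM : ∀ m ∈ ({2, 3, 4, 5, 10, 16, 17, 19, 89} : Set ℕ), m ∈ triangularValues M) {n : ℕ}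
    (hn : n ∈ curiousSet) : n ∈ triangularValues M := by
  have h432 := mem_triangularValues_four_three_two_of_mem_curiousSet hn
  have hcheck := (mem_triangularValues_coe_iff (by simp)).1 h432
  have h1 : n ≠ 1 := by
    rintro rfl
    exact absurd hcheck (by decide +kernel)
  have h8 : n ≠ 8 := by
    rintro rfl
    exact absurd hcheck (by decide +kernel)
  obtain ⟨c, hle, hc, hc0⟩ := exists_cons_le_of_mem_triangularValues (l := []) 0
    (Multiset.zero_le M) (hM 2 (by simp)) (by simp) (by decide +kernel)
  rw [zero_dvd_iff] at hc0
  obtain rfl | rfl : c = 1 ∨ c = 2 := by omega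
  · obtain ⟨c, hle, hc, hc0⟩ := exists_cons_le_of_mem_triangularValues 0 hle (hM 2 (by simp))
      (by simp) (by decide +kernel)
    rw [zero_dvd_iff] at hc0
    obtain rfl | rfl : c = 1 ∨ c = 2 := by omega
    · exact mem_triangularValues_of_one_one_le hle (hM 5 (by simp)) (hM 17 (by simp))
        (hM 89 (by simp)) h8
    · exact mem_triangularValues_of_two_one_le hle (hM 4 (by simp)) n
  · obtain ⟨c, hle, hc, hc2⟩ := exists_cons_le_of_mem_triangularValues 2 hle (hM 3 (by simp))
      (by simp) (by decide +kernel)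
    obtain rfl | rfl : c = 1 ∨ c = 3 := by omega
    · rw [show (([1, 2] : List ℕ) : Multiset ℕ) = [2, 1] by decide] at hle
      exact mem_triangularValues_of_two_one_le hle (hM 4 (by simp)) n
    · exact mem_triangularValues_of_three_two_le hle (hM 4 (by simp)) (hM 10 (by simp))
        (hM 16 (by simp)) (hM 19 (by simp)) h1 h432

theorem criticalSet_subset_curiousSet :
    ({2, 3, 4, 5, 10, 16, 17, 19, 89} : Set ℕ) ⊆ curiousSet := by
  rintro n (rfl | rfl | rfl | rfl | rfl | rfl | rfl | rfl | rfl)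
  · exact ⟨by norm_num, 3, 1, 1, by norm_num⟩
  · exact ⟨by norm_num, 1, 3, 1, by norm_num⟩
  · exact ⟨by norm_num, 1, 1, 3, by norm_num⟩
  · exact ⟨by norm_num, 3, 3, 1, by norm_num⟩
  · exact ⟨by norm_num, 5, 1, 3, by norm_num⟩
  · exact ⟨by norm_num, 7, 1, 3, by norm_num⟩
  · exact ⟨by norm_num, 3, 3, 5, by norm_num⟩
  · exact ⟨by norm_num, 5, 5, 3, by norm_num⟩
  · exact ⟨by norm_num, 3, 3, 13, by norm_num⟩

theorem theorem1p5 (k : ℕ) (b : Fin k → ℕ) (hb : ∀ i, 0 < b i) :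
    RepresentsSet b curiousSet ↔ RepresentsSet b {2, 3, 4, 5, 10, 16, 17, 19, 89} := by
  constructor
  · exact fun h n hn => h n (criticalSet_subset_curiousSet hn)
  · intro h n hn
    rw [exists_triangularSum_eq_iff]
    exact mem_triangularValues_of_mem_curiousSet
      (fun m hm => (exists_triangularSum_eq_iff b m).1 (h m hm)) hn
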